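/- For a cardinal number $\kappa$, let $\mathrm{LA}_\kappa$ ($\kappa$-linear arithmetic) be the first-order theory in the language $\langle 0,1,+,\le,a_\alpha\rangle_{\alpha\in\kappa}$, where $0,1$ are constants, $+$ is a binary and each $a_\alpha$ a unary function symbol and $\le$ is a binary relation symbol, with the following axioms (universally quantified over their free variables, with $\alpha,\beta\in\kappa$): - $0\neq z+1$; - $x+1=y+1\rightarrow x=y$; - $x+0=x$; - $x+(y+1)=(x+y)+1$; - $x\le y\leftrightarrow(\exists z)(x+z=y)$; - $a_\alpha(x+1)=a_\alpha x+a_\alpha 1$; - $a_\alpha(a_\beta x)=a_\beta(a_\alpha x)$; - induction: $\varphi(0,\bar y)\wedge(\forall x)(\varphi(x,\bar y)\rightarrow\varphi(x+1,\bar y))\rightarrow(\forall x)\varphi(x,\bar y)$ for every formula $\varphi(x,\bar y)$ of the language. A theory $T$ is called model complete if every embedding between models of $T$ is elementary. **Theorem.** For every cardinal $\kappa\ge 2$, the theory $\mathrm{LA}_\kappa$ is not model complete. In particular, $\mathrm{LA}_2$ is not model complete. -/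

import Mathlib

open FirstOrder FirstOrder.Language

namespace LinearArithmetic

/-- Function symbols of `κ`-linear arithmetic: constants `0`, `1`, binary `+`, and one unary symbol
`a_α` for every `α` in the index type `ι`. -/
inductive LinFunc (ι : Type*) : ℕ → Type _
  | zero : LinFunc ι 0
  | one : LinFunc ι 0
  | add : LinFunc ι 2
  | scalar (α : ι) : LinFunc ι 1

/-- The language `⟨0, 1, +, ≤, a_α⟩_{α ∈ ι}`; its only relation symbol is the binary symbol `≤`. -/
def lin (ι : Type*) : FirstOrder.Language := ⟨LinFunc ι, orderRel⟩

instance (ι : Type*) : (lin ι).IsOrdered := ⟨orderRel.le⟩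

section Terms

variable {ι β : Type*}

instance : Zero ((lin ι).Term β) := ⟨Constants.term (L := lin ι) LinFunc.zero⟩

instance : One ((lin ι).Term β) := ⟨Constants.term (L := lin ι) LinFunc.one⟩

instance : Add ((lin ι).Term β) := ⟨Functions.apply₂ (L := lin ι) LinFunc.add⟩

/-- The term `a_α t`. -/
def scal (α : ι) (t : (lin ι).Term β) : (lin ι).Term β :=
  Functions.apply₁ (L := lin ι) (LinFunc.scalar α) t

end Terms

section Axioms

variable (ι : Type*)

/-- `∀ z, 0 ≠ z + 1` -/
def axA1 : (lin ι).Sentence := ∀' ∼(0 =' (&0 + 1))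

/-- `∀ x y, x + 1 = y + 1 → x = y` -/
def axA2 : (lin ι).Sentence := ∀' ∀' (((&0 + 1) =' (&1 + 1)) ⟹ (&0 =' &1))

/-- `∀ x, x + 0 = x` -/
def axA3 : (lin ι).Sentence := ∀' ((&0 + 0) =' &0)

/-- `∀ x y, x + (y + 1) = (x + y) + 1` -/
def axA4 : (lin ι).Sentence := ∀' ∀' ((&0 + (&1 + 1)) =' ((&0 + &1) + 1))

/-- `∀ x y, x ≤ y ↔ ∃ z, x + z = y` -/
def axLe : (lin ι).Sentence := ∀' ∀' ((Term.le &0 &1) ⇔ ∃' ((&0 + &2) =' &1))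

variable {ι}

/-- `∀ x, a_α (x + 1) = a_α x + a_α 1` -/
def axL1 (α : ι) : (lin ι).Sentence := ∀' (scal α (&0 + 1) =' (scal α &0 + scal α 1))

/-- `∀ x, a_α (a_β x) = a_β (a_α x)` -/
def axL2 (α β : ι) : (lin ι).Sentence := ∀' (scal α (scal β &0) =' scal β (scal α &0))

/-- The formula `φ(0, ȳ)`; the variables of `φ(x, ȳ)` are `x = Sum.inr 0` and the parameters
`y_i = Sum.inl i`. -/
def substZero {n : ℕ} (φ : (lin ι).Formula (Fin n ⊕ Fin 1)) : (lin ι).Formula (Fin n) :=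
  BoundedFormula.subst φ (Sum.elim (fun i => Term.var i) (fun _ => 0))

/-- The formula `φ(x + 1, ȳ)`. -/
def substSucc {n : ℕ} (φ : (lin ι).Formula (Fin n ⊕ Fin 1)) :
    (lin ι).Formula (Fin n ⊕ Fin 1) :=
  BoundedFormula.subst φ
    (Sum.elim (fun i => Term.var (Sum.inl i)) (fun _ => Term.var (Sum.inr 0) + 1))

/-- `∀ x, φ(x, ȳ)`, as a formula in the parameters `ȳ`. -/
noncomputable def allX {n : ℕ} (φ : (lin ι).Formula (Fin n ⊕ Fin 1)) : (lin ι).Formula (Fin n) :=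
  Formula.iAlls (Fin 1) φ

/-- The universal closure of a formula in the parameters `ȳ`. -/
noncomputable def closure {n : ℕ} (φ : (lin ι).Formula (Fin n)) : (lin ι).Sentence :=
  Formula.iAlls (Fin n) (φ.relabel (Sum.inr : Fin n → Empty ⊕ Fin n))

/-- The instance of induction for `φ(x, ȳ)`:
`∀ ȳ, φ(0, ȳ) ∧ (∀ x, φ(x, ȳ) → φ(x + 1, ȳ)) → ∀ x, φ(x, ȳ)`. -/
noncomputable def axInd {n : ℕ} (φ : (lin ι).Formula (Fin n ⊕ Fin 1)) : (lin ι).Sentence :=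
  closure ((substZero φ ⊓ allX (φ.imp (substSucc φ))).imp (allX φ))

/-- The axioms of `κ`-linear arithmetic, `κ` being the cardinality of the index type `ι`. -/
inductive IsAxiom : (lin ι).Sentence → Prop
  | A1 : IsAxiom (axA1 ι)
  | A2 : IsAxiom (axA2 ι)
  | A3 : IsAxiom (axA3 ι)
  | A4 : IsAxiom (axA4 ι)
  | le : IsAxiom (axLe ι)
  | L1 (α : ι) : IsAxiom (axL1 α)
  | L2 (α β : ι) : IsAxiom (axL2 α β)
  | ind {n : ℕ} (φ : (lin ι).Formula (Fin n ⊕ Fin 1)) : IsAxiom (axInd φ)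

end Axioms

/-- The first-order theory `LA_κ`, with `κ` the cardinality of `ι`. -/
def LA (ι : Type*) : (lin ι).Theory := {σ | IsAxiom σ}

universe u v

/-- A theory is model complete if every embedding between models of it is elementary. As in
Mathlib's `Theory.IsSatisfiable` and `Theory.ModelsBoundedFormula`, the models range over the
universe of the language; by the Löwenheim-Skolem theorem larger universes give the same notion. -/
def ModelComplete {L : FirstOrder.Language.{u, v}} (T : L.Theory) : Prop :=
  ∀ (M N : Theory.ModelType.{u, v, max u v} T) (f : M ↪[L] N),
    ∃ g : M ↪ₑ[L] N, g.toEmbedding = f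

end LinearArithmetic

/-! An embedding need not preserve being an extreme point of the set of lattice points of a cone.
The points (x_k, y_k) with y² = 2x² + 1 lie on a branch of a hyperbola, and their ratios x_k / y_k
increase. With scalars a = x_n, b = y_n, the nonzero lattice points of b x ≤ a y satisfy 2x² + 1 ≤
y², so strict convexity makes every (x_k, y_k) with k ≤ n extreme (`isExtreme_pell`), and a
first-order formula says so. Take the ultraproduct over pairs (i, n) and send g to the average of
g(i, n) and g(j, n) in the ultraproduct over triples (j, i, n). Ultrafilters decide parity, so the
average is integral; both terms use the scalars of index n, so the average is an embedding
(`average`). The class of (x_i, y_i) is extreme, but its image is the midpoint of the distinct cone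
points (x_i, y_i) and (x_j, y_j). -/

namespace LinearArithmetic

/-! ### The standard models: `ℕ` with arbitrary scalars -/

section Standard

/-- The natural numbers, with `a_α` interpreted as multiplication by `s α`. -/
@[nolint unusedArguments]
def ScalarNat {ι : Type*} (_s : ι → ℕ) : Type _ := ULift.{u_1} ℕ

variable {ι : Type*} {s : ι → ℕ}

instance : Nonempty (ScalarNat s) := ⟨ULift.up 0⟩

instance : (lin ι).Structure (ScalarNat s) where
  funMap {_} g x := match g with
    | LinFunc.zero => ULift.up 0
    | LinFunc.one => ULift.up 1
    | LinFunc.add => ULift.up ((x 0).down + (x 1).down)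
    | LinFunc.scalar α => ULift.up (s α * (x 0).down)
  RelMap {_} r x := match r with
    | orderRel.le => (x 0).down ≤ (x 1).down

variable {β : Type*} {v : β → ScalarNat s}

@[simp] theorem realize_zero : (Term.realize v (0 : (lin ι).Term β)).down = 0 := rfl

@[simp] theorem realize_one : (Term.realize v (1 : (lin ι).Term β)).down = 1 := rfl

@[simp] theorem realize_add (t t' : (lin ι).Term β) :
    (Term.realize v (t + t')).down = (Term.realize v t).down + (Term.realize v t').down := rfl

@[simp] theorem realize_scal (α : ι) (t : (lin ι).Term β) :
    (Term.realize v (scal α t)).down = s α * (Term.realize v t).down := rfl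

theorem relMap_le (x : Fin 2 → ScalarNat s) :
    Structure.RelMap (L := lin ι) (leSymb : (lin ι).Relations 2) x ↔
      (x 0).down ≤ (x 1).down := Iff.rfl

@[simp] theorem realize_le {n : ℕ} (t t' : (lin ι).Term (β ⊕ Fin n)) (xs : Fin n → ScalarNat s) :
    (Term.le t t').Realize v xs ↔
      (t.realize (Sum.elim v xs)).down ≤ (t'.realize (Sum.elim v xs)).down := by
  rw [Term.le, BoundedFormula.realize_rel₂]
  exact Iff.rfl

theorem scalarNat_eq_iff (x y : ScalarNat s) : x = y ↔ x.down = y.down := ULift.ext_iff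

theorem realize_axInd {n : ℕ} (φ : (lin ι).Formula (Fin n ⊕ Fin 1)) :
    ScalarNat s ⊨ axInd φ := by
  rw [axInd, closure, Sentence.Realize, Formula.realize_iAlls]
  intro y
  rw [Formula.realize_relabel]
  intro h
  rw [BoundedFormula.realize_inf] at h
  obtain ⟨h0, h1⟩ := h
  replace h1 := Formula.realize_iAlls.1 h1
  refine Formula.realize_iAlls.2 fun x => ?_
  rw [substZero, BoundedFormula.realize_subst] at h0
  have key : ∀ k : ℕ, φ.Realize (Sum.elim y fun _ => ULift.up k) := by
    intro k
    induction k with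
    | zero =>
      refine (congrArg (Formula.Realize φ) (funext ?_)).mpr h0
      rintro (i | i) <;> rfl
    | succ k ih =>
      have h2 := h1 (fun _ => ULift.up k) ih
      rw [substSucc] at h2
      refine (congrArg (Formula.Realize φ) (funext ?_)).mpr (BoundedFormula.realize_subst.1 h2)
      rintro (i | i) <;> rfl
  refine (congrArg (Formula.Realize φ) (funext ?_)).mpr (key (x 0).down)
  rintro (i | i)
  · rfl
  · exact congrArg x (Subsingleton.elim i 0)

theorem scalarNat_models_LA : ScalarNat s ⊨ LA ι := by
  refine ⟨fun σ hσ => ?_⟩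
  cases hσ with
  | ind φ => exact realize_axInd φ
  | le =>
    simp [axLe, Sentence.Realize, Formula.Realize, Fin.snoc, scalarNat_eq_iff]
    intro x y
    exact ⟨fun h => ⟨ULift.up (y.down - x.down), Nat.add_sub_cancel' h⟩,
      fun ⟨z, hz⟩ => hz ▸ Nat.le_add_right _ _⟩
  | A1 => simp [axA1, Sentence.Realize, Formula.Realize, Fin.snoc, scalarNat_eq_iff]
  | A2 => simp [axA2, Sentence.Realize, Formula.Realize, Fin.snoc, scalarNat_eq_iff]
  | A3 => simp [axA3, Sentence.Realize, Formula.Realize, Fin.snoc, scalarNat_eq_iff]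
  | A4 => simp [axA4, Sentence.Realize, Formula.Realize, Fin.snoc, scalarNat_eq_iff, add_assoc]
  | L1 α => simp [axL1, Sentence.Realize, Formula.Realize, Fin.snoc, scalarNat_eq_iff, mul_add]
  | L2 α β =>
    simp [axL2, Sentence.Realize, Formula.Realize, Fin.snoc, scalarNat_eq_iff, mul_left_comm]

/-- The lattice point `(x, y)` lies in the cone `b x ≤ a y`, and is not on its `y = 0` face. -/
def coneFormula (a b : ι) (x y : (lin ι).Term β) : (lin ι).Formula β :=
  ∼(Term.equal y 0) ⊓ Relations.formula₂ (leSymb : (lin ι).Relations 2) (scal b x) (scal a y)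

theorem realize_coneFormula (a b : ι) (x y : (lin ι).Term β) :
    (coneFormula a b x y).Realize v ↔
      (y.realize v).down ≠ 0 ∧ s b * (x.realize v).down ≤ s a * (y.realize v).down := by
  rw [coneFormula, Formula.realize_inf, Formula.realize_not, Formula.realize_equal,
    Formula.realize_rel₂, relMap_le, scalarNat_eq_iff]
  rfl

/-- The lattice point in the free variables lies in the cone of `coneFormula`, and it is not the
midpoint of two lattice points of this cone with different abscissas. -/
noncomputable def extremeFormula (a b : ι) : (lin ι).Formula (Fin 2) :=
  coneFormula a b (Term.var 0) (Term.var 1) ⊓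
  Formula.iAlls (Fin 4)
    ((coneFormula a b (Term.var (Sum.inr 0)) (Term.var (Sum.inr 1)) ⊓
      coneFormula a b (Term.var (Sum.inr 2)) (Term.var (Sum.inr 3)) ⊓
      Term.equal (Term.var (Sum.inr 0) + Term.var (Sum.inr 2))
        (Term.var (Sum.inl 0) + Term.var (Sum.inl 0)) ⊓
      Term.equal (Term.var (Sum.inr 1) + Term.var (Sum.inr 3))
        (Term.var (Sum.inl 1) + Term.var (Sum.inl 1))).imp
    (Term.equal (Term.var (Sum.inr 0)) (Term.var (Sum.inr 2))))

/-- The property of `(x, y)` defined by `extremeFormula`, for scalars `a` and `b`. -/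
def IsExtreme (a b x y : ℕ) : Prop :=
  (y ≠ 0 ∧ b * x ≤ a * y) ∧ ∀ p q p' q' : ℕ, q ≠ 0 → b * p ≤ a * q → q' ≠ 0 → b * p' ≤ a * q' →
    p + p' = x + x → q + q' = y + y → p = p'

theorem realize_extremeFormula (a b : ι) (w : Fin 2 → ScalarNat s) :
    (extremeFormula a b).Realize w ↔ IsExtreme (s a) (s b) (w 0).down (w 1).down := by
  rw [extremeFormula, Formula.realize_inf, Formula.realize_iAlls, realize_coneFormula, IsExtreme]
  refine and_congr Iff.rfl ?_
  simp only [Formula.realize_imp, Formula.realize_inf, realize_coneFormula, Formula.realize_equal,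
    scalarNat_eq_iff, realize_add, Term.realize_var, Sum.elim_inl, Sum.elim_inr]
  constructor
  · intro h p q p' q' h1 h2 h3 h4 h5 h6
    exact h ![ULift.up p, ULift.up q, ULift.up p', ULift.up q'] ⟨⟨⟨⟨h1, h2⟩, h3, h4⟩, h5⟩, h6⟩
  · rintro h i ⟨⟨⟨⟨h1, h2⟩, h3, h4⟩, h5⟩, h6⟩
    exact h _ _ _ _ h1 h2 h3 h4 h5 h6

end Standard

/-! ### Solutions of the Pell equation -/

/-- The solutions `(x, y)` of `y ^ 2 = 2 * x ^ 2 + 1`. -/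
def pell : ℕ → ℕ × ℕ
  | 0 => (0, 1)
  | k + 1 => (3 * (pell k).1 + 2 * (pell k).2, 4 * (pell k).1 + 3 * (pell k).2)

theorem pell_spec (k : ℕ) : (pell k).2 ^ 2 = 2 * (pell k).1 ^ 2 + 1 := by
  induction k with
  | zero => rfl
  | succ k ih => simp only [pell]; linarith

theorem pell_snd_ne_zero (k : ℕ) : (pell k).2 ≠ 0 := by
  intro h
  have := pell_spec k
  simp [h] at this

theorem pell_fst_strictMono : StrictMono fun k => (pell k).1 := by
  refine strictMono_nat_of_lt_succ fun k => ?_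
  have := pell_snd_ne_zero k
  simp only [pell]
  lia

/-- After squaring and substituting the Pell equation, the claim reduces to x_k² ≤ x_n². -/
theorem pell_mem_cone {k n : ℕ} (h : k ≤ n) :
    (pell n).2 * (pell k).1 ≤ (pell n).1 * (pell k).2 := by
  have h1 := Nat.pow_le_pow_left (pell_fst_strictMono.monotone h) 2
  refine (Nat.pow_le_pow_iff_left two_ne_zero).1 ?_
  simp only [mul_pow, pell_spec]
  linarith

/-- The slope x_n / y_n is below 1 / √2, so q² > 2p², and integrality gains the 1. -/
theorem two_mul_sq_lt_of_mem_cone {n p q : ℕ} (hq : q ≠ 0)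
    (h : (pell n).2 * p ≤ (pell n).1 * q) : 2 * p ^ 2 + 1 ≤ q ^ 2 := by
  have h1 := Nat.pow_le_pow_left h 2
  simp only [mul_pow, pell_spec] at h1
  by_contra! h2
  have h3 : q ^ 2 ≤ 2 * p ^ 2 := by lia
  have h4 : 0 < q ^ 2 := by positivity
  nlinarith [Nat.mul_le_mul_left ((pell n).1 ^ 2) h3]

theorem isExtreme_pell {k n : ℕ} (h : k ≤ n) :
    IsExtreme (pell n).1 (pell n).2 (pell k).1 (pell k).2 := by
  refine ⟨⟨pell_snd_ne_zero k, pell_mem_cone h⟩, fun p q p' q' hq hp hq' hp' h1 h2 => ?_⟩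
  have e := two_mul_sq_lt_of_mem_cone hq hp
  have e' := two_mul_sq_lt_of_mem_cone hq' hp'
  -- Reverse Cauchy–Schwarz inequality for the form q² - 2p².
  have hB : 2 * (p * p') + 1 ≤ q * q' := by
    by_contra! hlt
    have h3 : q * q' ≤ 2 * (p * p') := by lia
    have h4 := Nat.mul_le_mul h3 h3
    have h5 := Nat.mul_le_mul e e'
    nlinarith [sq_nonneg (p : ℤ), Nat.zero_le (p ^ 2), Nat.zero_le (p' ^ 2)]
  have hv := pell_spec k
  generalize (pell k).1 = x at *
  generalize (pell k).2 = y at *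
  have hs : (q + q') ^ 2 = 2 * (p + p') ^ 2 + 4 := by rw [h1, h2]; linarith
  zify at *
  -- `hs` forces equality in `e`, `e'` and `hB`, so the difference of the two points is isotropic;
  -- irrationality of √2 then makes it zero.
  have hd : (q - q' : ℤ) ^ 2 = 2 * (p - p') ^ 2 := by linarith
  by_contra hne
  have hne' : (p - p' : ℝ) ≠ 0 := sub_ne_zero.2 (by exact_mod_cast hne)
  have hd' : (q - q' : ℝ) ^ 2 = 2 * (p - p') ^ 2 := by exact_mod_cast hd
  refine irrational_sqrt_two ⟨|(q - q') / (p - p')|, ?_⟩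
  push_cast
  rw [← Real.sqrt_sq_eq_abs, div_pow, hd', mul_div_cancel_right₀ _ (pow_ne_zero 2 hne')]

/-! ### The two ultraproducts and the embedding -/

section Ultraproduct

open Filter

/-- The ultrafilter of the sets `A` of pairs with `(i, n) ∈ A` for almost all `i` and then almost
all `n`. -/
noncomputable def pairs : Ultrafilter (ℕ × ℕ) :=
  (hyperfilter ℕ).bind fun i => (hyperfilter ℕ).map fun n => (i, n)

/-- The ultrafilter of the sets `A` of triples with `(j, i, n) ∈ A` for almost all `j`, then almost
all `i` and then almost all `n`. -/
noncomputable def triples : Ultrafilter (ℕ × ℕ × ℕ) :=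
  (hyperfilter ℕ).bind fun j => pairs.map fun t => (j, t)

theorem eventually_pairs {P : ℕ × ℕ → Prop} :
    (∀ᶠ t in (pairs : Filter (ℕ × ℕ)), P t) ↔
      ∀ᶠ i in (hyperfilter ℕ : Filter ℕ), ∀ᶠ n in (hyperfilter ℕ : Filter ℕ), P (i, n) := Iff.rfl

theorem eventually_triples {P : ℕ × ℕ × ℕ → Prop} :
    (∀ᶠ t in (triples : Filter (ℕ × ℕ × ℕ)), P t) ↔
      ∀ᶠ j in (hyperfilter ℕ : Filter ℕ), ∀ᶠ t in (pairs : Filter (ℕ × ℕ)), P (j, t) := Iff.rfl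

/-- Both projections (j, i, n) ↦ (i, n) and (j, i, n) ↦ (j, n) carry `triples` to `pairs`, since the
omitted index is a dummy quantifier. -/
theorem eventually_triples_of_pairs {P : ℕ × ℕ → Prop}
    (h : ∀ᶠ t in (pairs : Filter (ℕ × ℕ)), P t) :
    (∀ᶠ t in (triples : Filter (ℕ × ℕ × ℕ)), P (t.2.1, t.2.2) ∧ P (t.1, t.2.2)) := by
  refine Eventually.and (eventually_triples.2 (Eventually.of_forall fun _ => h)) ?_
  refine eventually_triples.2 ((eventually_pairs.1 h).mono fun j hj => ?_)
  exact eventually_pairs.2 (Eventually.of_forall fun _ => hj)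

variable {ι : Type*} (s : ℕ → ι → ℕ)

/-- The ultraproduct of the standard models `ScalarNat (s n)` over the pairs `(i, n)`. -/
abbrev PairModel : Type _ := (pairs : Filter (ℕ × ℕ)).Product fun t => ScalarNat (s t.2)

/-- The ultraproduct of the standard models `ScalarNat (s n)` over the triples `(j, i, n)`. -/
abbrev TripleModel : Type _ := (triples : Filter (ℕ × ℕ × ℕ)).Product fun t => ScalarNat (s t.2.2)

instance : PairModel s ⊨ LA ι :=
  ⟨fun σ hσ => (Ultraproduct.sentence_realize σ).2
    (Eventually.of_forall fun _ => scalarNat_models_LA.realize_of_mem σ hσ)⟩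

instance : TripleModel s ⊨ LA ι :=
  ⟨fun σ hσ => (Ultraproduct.sentence_realize σ).2
    (Eventually.of_forall fun _ => scalarNat_models_LA.realize_of_mem σ hσ)⟩

variable {s}

/-- The average of the two pullbacks of a function on pairs along `(j, i, n) ↦ (i, n)` and
`(j, i, n) ↦ (j, n)`. -/
def averageFun (g : ∀ t : ℕ × ℕ, ScalarNat (s t.2)) (t : ℕ × ℕ × ℕ) : ScalarNat (s t.2.2) :=
  ULift.up (((g (t.2.1, t.2.2)).down + (g (t.1, t.2.2)).down) / 2)

/-- The ultrafilter decides the parity of g, so both pullbacks have the same parity and the halving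
is exact. -/
theorem two_mul_averageFun (g : ∀ t : ℕ × ℕ, ScalarNat (s t.2)) :
    ∀ᶠ t in (triples : Filter (ℕ × ℕ × ℕ)), 2 * (averageFun g t).down =
      (g (t.2.1, t.2.2)).down + (g (t.1, t.2.2)).down := by
  rcases Ultrafilter.em pairs fun t => Even (g t).down with h | h
  all_goals
    filter_upwards [eventually_triples_of_pairs h] with t ht
    refine Nat.two_mul_div_two_of_even ?_
    rw [Nat.even_add]
    tauto

theorem averageFun_le_iff (g h : ∀ t : ℕ × ℕ, ScalarNat (s t.2)) :
    (∀ᶠ t in (triples : Filter (ℕ × ℕ × ℕ)), (averageFun g t).down ≤ (averageFun h t).down) ↔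
      ∀ᶠ t in (pairs : Filter (ℕ × ℕ)), (g t).down ≤ (h t).down := by
  refine ⟨fun H => ?_, fun H => ?_⟩
  -- For an ultrafilter, failure of g ≤ h means g > h almost everywhere, hence in both pullbacks at
  -- once.
  · by_contra hn
    obtain ⟨t, ht, h1, h2, h3⟩ := ((eventually_triples_of_pairs
      (Ultrafilter.eventually_not.2 hn)).and (H.and
      ((two_mul_averageFun g).and (two_mul_averageFun h)))).exists
    lia
  · filter_upwards [eventually_triples_of_pairs H] with t ht
    exact Nat.div_le_div_right (Nat.add_le_add ht.1 ht.2)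

theorem averageFun_eq_iff (g h : ∀ t : ℕ × ℕ, ScalarNat (s t.2)) :
    (∀ᶠ t in (triples : Filter (ℕ × ℕ × ℕ)), averageFun g t = averageFun h t) ↔
      ∀ᶠ t in (pairs : Filter (ℕ × ℕ)), g t = h t := by
  simp only [scalarNat_eq_iff, le_antisymm_iff, eventually_and, averageFun_le_iff]

/-- Every operation is affine, and the scalars depend only on n, which both pullbacks share. -/
theorem averageFun_funMap {k : ℕ} (c : (lin ι).Functions k)
    (g : Fin k → ∀ t : ℕ × ℕ, ScalarNat (s t.2)) :
    ∀ᶠ t in (triples : Filter (ℕ × ℕ × ℕ)),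
      averageFun (fun t => Structure.funMap c fun i => g i t) t =
        Structure.funMap c fun i => averageFun (g i) t := by
  have H : ∀ᶠ t in (triples : Filter (ℕ × ℕ × ℕ)), ∀ i, 2 * (averageFun (g i) t).down =
      (g i (t.2.1, t.2.2)).down + (g i (t.1, t.2.2)).down :=
    eventually_all.2 fun i => two_mul_averageFun (g i)
  filter_upwards [H, two_mul_averageFun fun t => Structure.funMap c fun i => g i t] with t h1 h2
  rw [scalarNat_eq_iff]
  refine Nat.eq_of_mul_eq_mul_left two_pos (h2.trans ?_)
  cases c with
  | zero => rfl
  | one => rfl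
  | add =>
    change (_ + _) + (_ + _) = 2 * (_ + _)
    rw [mul_add, h1, h1]
    ring
  | scalar α =>
    change _ * _ + _ * _ = 2 * (_ * _)
    rw [mul_left_comm, h1]
    ring

/-- The map of ultraproducts induced by `averageFun`. -/
noncomputable def averageMap : PairModel s → TripleModel s :=
  Quotient.map averageFun fun g h e => (averageFun_eq_iff g h).2 e

theorem averageMap_comp_cast {k : ℕ} (g : Fin k → ∀ t : ℕ × ℕ, ScalarNat (s t.2)) :
    (averageMap ∘ fun i => (g i : PairModel s)) = fun i => (averageFun (g i) : TripleModel s) :=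
  rfl

theorem exists_eq_cast {k : ℕ} (x : Fin k → PairModel s) :
    ∃ g : Fin k → ∀ t : ℕ × ℕ, ScalarNat (s t.2), x = fun i => (g i : PairModel s) :=
  ⟨fun i => (x i).out, funext fun i => ((x i).out_eq).symm⟩

theorem relMap_cast {α : Type*} {u : Ultrafilter α} {L : FirstOrder.Language} {M : α → Type*}
    [∀ a, L.Structure (M a)] {k : ℕ} (r : L.Relations k) (x : Fin k → ∀ a, M a) :
    (Structure.RelMap r fun i => (x i : (u : Filter α).Product M)) ↔
      ∀ᶠ a in (u : Filter α), Structure.RelMap r fun i => x i a :=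
  @relMap_quotient_mk' L _ ((u : Filter α).productSetoid M)
    (Ultraproduct.setoidPrestructure M u) k r x

variable (s) in
/-- The embedding of ultraproducts induced by `averageFun`. -/
noncomputable def average : PairModel s ↪[lin ι] TripleModel s where
  toFun := averageMap
  inj' := by
    rintro ⟨g⟩ ⟨h⟩ e
    exact Quotient.sound ((averageFun_eq_iff g h).1 (Quotient.exact e))
  map_fun' c x := by
    obtain ⟨g, rfl⟩ := exists_eq_cast x
    refine (congrArg averageMap (Ultraproduct.funMap_cast c g)).trans (Eq.trans ?_
      (Ultraproduct.funMap_cast c fun i => averageFun (g i)).symm)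
    exact Quotient.sound (averageFun_funMap c g)
  map_rel' r x := by
    obtain ⟨g, rfl⟩ := exists_eq_cast x
    refine (relMap_cast r fun i => averageFun (g i)).trans (Iff.trans ?_ (relMap_cast r g).symm)
    cases r
    exact averageFun_le_iff (g 0) (g 1)

end Ultraproduct

open Filter in
theorem not_modelComplete {ι : Type*} {a b : ι} (hab : a ≠ b) : ¬ ModelComplete (LA ι) := by
  classical
  intro H
  -- Only the values at a and b matter; the other scalars are arbitrary.
  let s : ℕ → ι → ℕ := fun n α => if α = a then (pell n).1 else (pell n).2
  have ha n : s n a = (pell n).1 := if_pos rfl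
  have hb n : s n b = (pell n).2 := if_neg hab.symm
  obtain ⟨f, hf⟩ := H (Theory.ModelType.of (LA ι) (PairModel s))
    (Theory.ModelType.of (LA ι) (TripleModel s)) (average s)
  let g : Fin 2 → ∀ t : ℕ × ℕ, ScalarNat (s t.2) :=
    ![fun t => ULift.up (pell t.1).1, fun t => ULift.up (pell t.1).2]
  have hg : (extremeFormula a b).Realize fun i => (g i : PairModel s) := by
    refine (Ultraproduct.realize_formula_cast _ g).2 (eventually_pairs.2 ?_)
    refine Eventually.of_forall fun i => ?_
    filter_upwards [(Nat.hyperfilter_le_atTop) (eventually_ge_atTop i)] with n hn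
    rw [realize_extremeFormula, ha, hb]
    exact isExtreme_pell hn
  have hfg : (extremeFormula a b).Realize fun i => (averageFun (g i) : TripleModel s) := by
    have h1 := (f.map_formula (extremeFormula a b) fun i => (g i : PairModel s)).2 hg
    have h2 : (f : PairModel s → TripleModel s) = averageMap :=
      congrArg (fun e : PairModel s ↪[lin ι] TripleModel s => ⇑e) hf
    rw [← averageMap_comp_cast, ← h2]
    exact h1
  have hne : ∀ᶠ t in (triples : Filter (ℕ × ℕ × ℕ)), (t.2.1 ≤ t.2.2 ∧ t.1 ≤ t.2.2) ∧
      t.2.1 ≠ t.1 := by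
    refine (eventually_triples_of_pairs (P := fun t => t.1 ≤ t.2) ?_).and ?_
    · exact eventually_pairs.2 (Eventually.of_forall fun i =>
        Nat.hyperfilter_le_atTop (eventually_ge_atTop i))
    -- For fixed j almost all i exceed j, by nonprincipality.
    · refine eventually_triples.2 (Eventually.of_forall fun j => eventually_pairs.2 ?_)
      filter_upwards [Nat.hyperfilter_le_atTop (eventually_gt_atTop j)] with i hi
      exact Eventually.of_forall fun _ => hi.ne'
  obtain ⟨⟨j, i, n⟩, h1, ⟨⟨hi, hj⟩, hij⟩, h2, h3⟩ :=
    (((Ultraproduct.realize_formula_cast _ fun i => averageFun (g i)).1 hfg).and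
      (hne.and ((two_mul_averageFun (g 0)).and (two_mul_averageFun (g 1))))).exists
  rw [realize_extremeFormula, ha, hb] at h1
  -- Extremeness of the average of the i-th and j-th Pell points would give them equal abscissas,
  -- hence i = j.
  refine hij (pell_fst_strictMono.injective (h1.2 _ (pell i).2 _ (pell j).2 (pell_snd_ne_zero i)
    (pell_mem_cone hi) (pell_snd_ne_zero j) (pell_mem_cone hj) ?_ ?_))
  · exact h2.symm.trans (two_mul _)
  · exact h3.symm.trans (two_mul _)

end LinearArithmetic

theorem mainTheorem3 (ι : Type*) (hι : 2 ≤ Cardinal.mk ι) :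
    ¬ LinearArithmetic.ModelComplete (LinearArithmetic.LA ι) := by
  obtain ⟨a, b, hab⟩ := Cardinal.two_le_iff.1 hι
  exact LinearArithmetic.not_modelComplete hab
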